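/- All Banach spaces are real; a pointed metric space is a metric space $X$ with a distinguished point $0$. Let $1\le p<\infty$. For a pointed metric space $X$ and Banach spaces $E,F$, let $LipL_0(X\times E;F)$ be the space of maps $T:X\times E\to F$ such that $T(x,\cdot)$ is linear for every $x$, $T(0,e)=0$ for every $e$, and for some $C\ge 0$ $$\|T(x,e)-T(y,e)\|\le C\,d(x,y)\|e\|\qquad(x,y\in X,\ e\in E);$$ $LipL(T)$ is the least such $C$, and $B_{LipL_0(X\times E)}$ is the closed unit ball of $LipL_0(X\times E;\mathbb R)$. An operator $T\in LipL_0(X\times E;F)$ is *factorable strongly $p$-summing*, $T\in\Pi^{LipL}_{F,St,p}(X\times E;F)$, if there is $C\ge 0$ such that for all $n,m$ and all $x_i^j,y_i^j\in X$, $e_i^j\in E$ ($1\le i\le n$, $1\le j\le m$) $$\Big(\sum_{i=1}^n\Big\|\sum_{j=1}^m T(x_i^j,e_i^j)-T(y_i^j,e_i^j)\Big\|^p\Big)^{1/p}\le C\sup_{\varphi\in B_{LipL_0(X\times E)}}\Big(\sum_{i=1}^n\Big|\sum_{j=1}^m\varphi(x_i^j,e_i^j)-\varphi(y_i^j,e_i^j)\Big|^p\Big)^{1/p};$$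 $\pi^{LipL}_{F,St,p}(T)$ is the infimum of such $C$. A bounded linear operator $u:G\to F$ is *absolutely $p$-summing*, $u\in\Pi_p(G;F)$, if there is $C\ge 0$ with $(\sum_i\|u(g_i)\|^p)^{1/p}\le C\sup_{\|g^*\|\le 1}(\sum_i|g^*(g_i)|^p)^{1/p}$ for all finite families $(g_i)$ in $G$; $\pi_p(u)$ is the infimum of such $C$. Let $\Pi_p\circ LipL_0(X\times E;F)$ be the set of all $T=u\circ S$ with $S\in LipL_0(X\times E;G)$ and $u\in\Pi_p(G;F)$ for some Banach space $G$, with $\|T\|_{\Pi_p\circ LipL_0}=\inf\pi_p(u)\,LipL(S)$ over all such factorizations. A *Banach Lip-linear ideal* is a class $\mathcal I$ with components $\mathcal I(X\times E;F)\subseteq LipL_0(X\times E;F)$ and a function $\|\cdot\|_{\mathcal I}$ on it such that: every component is a vector subspace of $LipL_0(X\times E;F)$, is a Banach space under $\|\cdot\|_{\mathcal I}$, and satisfies $LipL(T)\le\|T\|_{\mathcal I}$; every map $(x,e)\mapsto f(x)e^*(e)z$ with $f:X\to\mathbb R$ Lipschitz, $f(0)=0$, $e^*\in E^*$, $z\in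 F$, belongs to $\mathcal I$; the map $\mathbb R\times\mathbb R\to\mathbb R$, $(\alpha,\beta)\mapsto\alpha\beta$, has $\|\cdot\|_{\mathcal I}=1$; and if $f:X\to X_0$ is Lipschitz with $f(0)=0$ and least Lipschitz constant $Lip(f)$, $v:E\to E_0$ and $u:F_0\to F$ are bounded linear, and $T\in\mathcal I(X_0\times E_0;F_0)$, then $u\circ T\circ(f,v)\in\mathcal I(X\times E;F)$ with $\|u\circ T\circ(f,v)\|_{\mathcal I}\le\|u\|\,\|T\|_{\mathcal I}\,Lip(f)\,\|v\|$. **Statement.** The class $\Pi^{LipL}_{F,St,p}$ with $\pi^{LipL}_{F,St,p}$ is a Banach Lip-linear ideal, and it is the one generated by the composition method from $\Pi_p$: for every pointed metric space $X$ and all Banach spaces $E,F$, $$\Pi^{LipL}_{F,St,p}(X\times E;F)=\Pi_p\circ LipL_0(X\times E;F),\qquad \pi^{LipL}_{F,St,p}(T)=\|T\|_{\Pi_p\circ LipL_0}\ \text{ for every } T \text{ in this class.}$$ -/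

import Mathlib

/-!
Throughout, Banach spaces are real, a pointed metric space is a metric space with a distinguished
point written `0`, and `p` is a real exponent (`1 ≤ p`).
-/

noncomputable section

namespace LipLinear

universe u v w t

/-- The space `LipL₀(X × E; F)`: maps `T : X × E → F` that are linear in the second variable, satisfy
`‖T(x,e) - T(y,e)‖ ≤ C d(x,y) ‖e‖` for some constant `C`, and vanish on `{0} × E`. -/
def LipL0 (X : Type u) [MetricSpace X] [Zero X]
    (E : Type v) [NormedAddCommGroup E] [NormedSpace ℝ E]
    (F : Type w) [NormedAddCommGroup F] [NormedSpace ℝ F] : Submodule ℝ (X × E → F) where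
  carrier := {T | (∀ x, IsLinearMap ℝ (fun e => T (x, e))) ∧
    (∃ C : ℝ, 0 ≤ C ∧ ∀ x y e, ‖T (x, e) - T (y, e)‖ ≤ C * dist x y * ‖e‖) ∧
    ∀ e, T (0, e) = 0}
  zero_mem' := ⟨fun _ => ⟨by simp, by simp⟩, ⟨0, le_rfl, by simp⟩, by simp⟩
  add_mem' := by
    rintro S T ⟨hS, ⟨C, hC, hSC⟩, hS0⟩ ⟨hT, ⟨D, hD, hTD⟩, hT0⟩
    refine ⟨fun x => ⟨fun a b => ?_, fun c a => ?_⟩, ⟨C + D, add_nonneg hC hD, fun x y e => ?_⟩,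
      fun e => by simp [hS0, hT0]⟩
    · have h1 := (hS x).map_add a b
      have h2 := (hT x).map_add a b
      simp only [Pi.add_apply] at *
      rw [h1, h2]; abel
    · have h1 := (hS x).map_smul c a
      have h2 := (hT x).map_smul c a
      simp only [Pi.add_apply] at *
      rw [h1, h2, smul_add]
    · have h : (S + T) (x, e) - (S + T) (y, e)
          = (S (x, e) - S (y, e)) + (T (x, e) - T (y, e)) := by
        simp only [Pi.add_apply]; abel
      rw [h]
      calc _ ≤ ‖S (x, e) - S (y, e)‖ + ‖T (x, e) - T (y, e)‖ := norm_add_le _ _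
        _ ≤ C * dist x y * ‖e‖ + D * dist x y * ‖e‖ := add_le_add (hSC x y e) (hTD x y e)
        _ = (C + D) * dist x y * ‖e‖ := by ring
  smul_mem' := by
    rintro c T ⟨hT, ⟨D, hD, hTD⟩, hT0⟩
    refine ⟨fun x => ⟨fun a b => ?_, fun r a => ?_⟩,
      ⟨|c| * D, mul_nonneg (abs_nonneg c) hD, fun x y e => ?_⟩, fun e => by simp [hT0]⟩
    · have h2 := (hT x).map_add a b
      simp only [Pi.smul_apply] at *
      rw [h2, smul_add]
    · have h2 := (hT x).map_smul r a
      simp only [Pi.smul_apply] at *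
      rw [h2, smul_comm]
    · simp only [Pi.smul_apply]
      rw [← smul_sub, norm_smul, Real.norm_eq_abs]
      calc _ ≤ |c| * (D * dist x y * ‖e‖) :=
            mul_le_mul_of_nonneg_left (hTD x y e) (abs_nonneg c)
        _ = |c| * D * dist x y * ‖e‖ := by ring

section Norms

variable {X : Type u} [MetricSpace X] [Zero X]
  {E : Type v} [NormedAddCommGroup E] [NormedSpace ℝ E]
  {F : Type w} [NormedAddCommGroup F] [NormedSpace ℝ F]

/-- The norm `LipL(T)`: the least constant `C` with
`‖T(x,e) - T(y,e)‖ ≤ C d(x,y) ‖e‖` for all `x, y, e`. -/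
def lipLNorm (T : LipL0 X E F) : ℝ :=
  sInf {C : ℝ | 0 ≤ C ∧ ∀ x y e, ‖T.1 (x, e) - T.1 (y, e)‖ ≤ C * dist x y * ‖e‖}

/-- `C` is an admissible constant in the definition of a factorable strongly `p`-summing operator.
The supremum is over the closed unit ball of `LipL₀(X × E; ℝ)`; the family is bounded above, and the
ball contains `0`, so it is a genuine supremum. -/
def FactStrongBound (p : ℝ) (T : LipL0 X E F) (C : ℝ) : Prop :=
  ∀ (n m : ℕ) (x y : Fin n → Fin m → X) (e : Fin n → Fin m → E),
    (∑ i, ‖∑ j, (T.1 (x i j, e i j) - T.1 (y i j, e i j))‖ ^ p) ^ (1 / p) ≤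
      C * ⨆ φ : {φ : LipL0 X E ℝ // lipLNorm φ ≤ 1},
        (∑ i, |∑ j, (φ.1.1 (x i j, e i j) - φ.1.1 (y i j, e i j))| ^ p) ^ (1 / p)

/-- The norm `π_{F,St,p}^{LipL}(T)`: the infimum of the admissible constants. -/
def factStrongNorm (p : ℝ) (T : LipL0 X E F) : ℝ :=
  sInf {C : ℝ | 0 ≤ C ∧ FactStrongBound p T C}

end Norms

/-- The class `Π_{F,St,p}^{LipL}(X × E; F)` of factorable strongly `p`-summing Lip-linear operators. -/
def FactStrong (p : ℝ) (X : Type u) [MetricSpace X] [Zero X]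
    (E : Type v) [NormedAddCommGroup E] [NormedSpace ℝ E]
    (F : Type w) [NormedAddCommGroup F] [NormedSpace ℝ F] : Set (LipL0 X E F) :=
  {T | ∃ C : ℝ, 0 ≤ C ∧ FactStrongBound p T C}

/-! ### Absolutely `p`-summing linear operators -/

section PSumming

variable {G : Type t} [NormedAddCommGroup G] [NormedSpace ℝ G]
  {F : Type w} [NormedAddCommGroup F] [NormedSpace ℝ F]

/-- `C` is an admissible constant in the definition of a `p`-summing operator; the supremum on the
right is the weak `ℓ_p` norm of the finite family `g`. -/
def PSummingBound (p : ℝ) (a : G →L[ℝ] F) (C : ℝ) : Prop :=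
  ∀ (n : ℕ) (g : Fin n → G),
    (∑ i, ‖a (g i)‖ ^ p) ^ (1 / p) ≤
      C * ⨆ f : {f : StrongDual ℝ G // ‖f‖ ≤ 1}, (∑ i, |f.1 (g i)| ^ p) ^ (1 / p)

/-- The norm `π_p`. -/
def pSummingNorm (p : ℝ) (a : G →L[ℝ] F) : ℝ :=
  sInf {C : ℝ | 0 ≤ C ∧ PSummingBound p a C}

end PSumming

/-- The class `Π_p(G; F)` of absolutely `p`-summing operators. -/
def PSumming (p : ℝ) (G : Type t) [NormedAddCommGroup G] [NormedSpace ℝ G]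
    (F : Type w) [NormedAddCommGroup F] [NormedSpace ℝ F] : Set (G →L[ℝ] F) :=
  {a | ∃ C : ℝ, 0 ≤ C ∧ PSummingBound p a C}

/-! ### The composition method -/

section Composition

variable {F : Type w} [NormedAddCommGroup F] [NormedSpace ℝ F]

/-- The class `I ∘ LipL₀(X × E; F)`: the operators `T = a ∘ S` with `S ∈ LipL₀(X × E; G)` and
`a ∈ I(G; F)` for some Banach space `G`. -/
def Composition
    (I : ∀ (G : Type t) [NormedAddCommGroup G] [NormedSpace ℝ G] [CompleteSpace G],
      Set (G →L[ℝ] F))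
    (X : Type u) [MetricSpace X] [Zero X]
    (E : Type v) [NormedAddCommGroup E] [NormedSpace ℝ E] : Set (LipL0 X E F) :=
  {T | ∃ (G : Type t) (_ : NormedAddCommGroup G) (_ : NormedSpace ℝ G) (_ : CompleteSpace G)
    (S : LipL0 X E G) (a : G →L[ℝ] F), a ∈ I G ∧ ∀ x e, T.1 (x, e) = a (S.1 (x, e))}

/-- The norm of `I ∘ LipL₀`: the infimum of `‖a‖_I LipL(S)` over all factorizations `T = a ∘ S`
with `a` in `I`, where `N` is the norm `‖·‖_I`. -/
def compositionNorm
    (I : ∀ (G : Type t) [NormedAddCommGroup G] [NormedSpace ℝ G] [CompleteSpace G],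
      Set (G →L[ℝ] F))
    (N : ∀ (G : Type t) [NormedAddCommGroup G] [NormedSpace ℝ G] [CompleteSpace G],
      (G →L[ℝ] F) → ℝ)
    {X : Type u} [MetricSpace X] [Zero X]
    {E : Type v} [NormedAddCommGroup E] [NormedSpace ℝ E] (T : LipL0 X E F) : ℝ :=
  sInf {r : ℝ | ∃ (G : Type t) (_ : NormedAddCommGroup G) (_ : NormedSpace ℝ G)
    (_ : CompleteSpace G) (S : LipL0 X E G) (a : G →L[ℝ] F), a ∈ I G ∧
      (∀ x e, T.1 (x, e) = a (S.1 (x, e))) ∧ r = N G a * lipLNorm S}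

end Composition

/-! ### Lip-linear ideals -/

/-- Membership in `Lip₀(X; Y)`: Lipschitz maps preserving the base point. -/
def IsLip0 {X : Type u} [MetricSpace X] [Zero X] {Y : Type v} [MetricSpace Y] [Zero Y]
    (f : X → Y) : Prop :=
  (∃ K : NNReal, LipschitzWith K f) ∧ f 0 = 0

/-- The least Lipschitz constant `Lip(f)`. -/
def lipNorm {X : Type u} [MetricSpace X] {Y : Type v} [MetricSpace Y] (f : X → Y) : ℝ :=
  sInf {C : ℝ | 0 ≤ C ∧ ∀ x y, dist (f x) (f y) ≤ C * dist x y}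

/-- The operator `f · e* · z : (x, e) ↦ f(x) e*(e) z`. -/
def elementary {X : Type u} [MetricSpace X] [Zero X]
    {E : Type v} [NormedAddCommGroup E] [NormedSpace ℝ E]
    {F : Type w} [NormedAddCommGroup F] [NormedSpace ℝ F]
    (f : X → ℝ) (hf : IsLip0 f) (b : StrongDual ℝ E) (z : F) : LipL0 X E F :=
  ⟨fun q => (f q.1 * b q.2) • z, by
    obtain ⟨⟨K, hK⟩, h0⟩ := hf
    refine ⟨fun x => ⟨fun a b => ?_, fun c a => ?_⟩,
      ⟨K * ‖b‖ * ‖z‖, by positivity, fun x y e => ?_⟩, fun e => by simp [h0]⟩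
    · simp only [map_add, mul_add, add_smul]
    · simp only [map_smul, smul_eq_mul, smul_smul]
      congr 1; ring
    · simp only []
      rw [← sub_smul, ← sub_mul, norm_smul, norm_mul]
      have h1 : ‖f x - f y‖ ≤ K * dist x y := by
        rw [← dist_eq_norm]; exact hK.dist_le_mul x y
      have h2 := b.le_opNorm e
      calc ‖f x - f y‖ * ‖b e‖ * ‖z‖ ≤ (K * dist x y) * (‖b‖ * ‖e‖) * ‖z‖ := by gcongr
        _ = K * ‖b‖ * ‖z‖ * dist x y * ‖e‖ := by ring⟩

/-- The composite `a ∘ T ∘ (f, c) : (x, e) ↦ a (T (f x, c e))`. -/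
def sandwich {X X₀ : Type u} [MetricSpace X] [Zero X] [MetricSpace X₀] [Zero X₀]
    {E E₀ : Type v} [NormedAddCommGroup E] [NormedSpace ℝ E]
    [NormedAddCommGroup E₀] [NormedSpace ℝ E₀]
    {F F₀ : Type w} [NormedAddCommGroup F] [NormedSpace ℝ F]
    [NormedAddCommGroup F₀] [NormedSpace ℝ F₀]
    (a : F₀ →L[ℝ] F) (T : LipL0 X₀ E₀ F₀) (f : X → X₀) (hf : IsLip0 f) (c : E →L[ℝ] E₀) :
    LipL0 X E F :=
  ⟨fun q => a (T.1 (f q.1, c q.2)), by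
    obtain ⟨⟨K, hK⟩, h0⟩ := hf
    obtain ⟨T, hT, ⟨D, hD, hTD⟩, hT0⟩ := T
    refine ⟨fun x => ⟨fun b d => ?_, fun r b => ?_⟩,
      ⟨‖a‖ * D * K * ‖c‖, by positivity, fun x y e => ?_⟩, fun e => by simp [h0, hT0]⟩
    · have h := (hT (f x)).map_add (c b) (c d)
      simp only [map_add] at *
      rw [h, map_add]
    · have h := (hT (f x)).map_smul r (c b)
      simp only [map_smul] at *
      rw [h, map_smul]
    · simp only []
      rw [← map_sub]
      have h1 := hK.dist_le_mul x y
      calc _ ≤ ‖a‖ * ‖T (f x, c e) - T (f y, c e)‖ := a.le_opNorm _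
        _ ≤ ‖a‖ * (D * dist (f x) (f y) * ‖c e‖) := by gcongr; exact hTD _ _ _
        _ ≤ ‖a‖ * (D * (K * dist x y) * (‖c‖ * ‖e‖)) := by gcongr; exact c.le_opNorm e
        _ = ‖a‖ * D * K * ‖c‖ * dist x y * ‖e‖ := by ring⟩

/-- The operator `ℝ × ℝ → ℝ`, `(α, β) ↦ α β`. The copies of `ℝ` are lifted to the universes at hand. -/
def mulReal : LipL0 (ULift.{u} ℝ) (ULift.{v} ℝ) (ULift.{w} ℝ) :=
  ⟨fun q => ULift.up (q.1.down * q.2.down), by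
    refine ⟨fun x => ⟨fun b d => ?_, fun r b => ?_⟩, ⟨1, zero_le_one, fun x y e => ?_⟩, fun e => ?_⟩
    · ext; simp [mul_add]
    · ext; simp [mul_left_comm]
    · have h : (ULift.up (x.down * e.down) - ULift.up (y.down * e.down) : ULift.{w} ℝ)
          = ULift.up ((x.down - y.down) * e.down) := by ext; simp [sub_mul]
      simp only []
      rw [h, one_mul, ULift.norm_up, norm_mul, ULift.norm_def, ULift.dist_eq, dist_eq_norm]
    · ext; simp⟩

/-- A class of Lip-linear operators, given by its components `I(X × E; F) ⊆ LipL₀(X × E; F)`. -/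
abbrev LipLinearClass : Type _ :=
  ∀ (X : Type u) [MetricSpace X] [Zero X]
    (E : Type v) [NormedAddCommGroup E] [NormedSpace ℝ E] [CompleteSpace E]
    (F : Type w) [NormedAddCommGroup F] [NormedSpace ℝ F] [CompleteSpace F], Set (LipL0 X E F)

/-- A real-valued function on Lip-linear operators (a candidate for the norm of an ideal). -/
abbrev LipLinearClassNorm : Type _ :=
  ∀ (X : Type u) [MetricSpace X] [Zero X]
    (E : Type v) [NormedAddCommGroup E] [NormedSpace ℝ E] [CompleteSpace E]
    (F : Type w) [NormedAddCommGroup F] [NormedSpace ℝ F] [CompleteSpace F], LipL0 X E F → ℝ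

/-- Lip-linear ideals. -/
structure IsLipLinearIdeal (I : LipLinearClass.{u, v, w}) : Prop where
  /-- Every component is a vector subspace. -/
  subspace : ∀ (X : Type u) [MetricSpace X] [Zero X]
    (E : Type v) [NormedAddCommGroup E] [NormedSpace ℝ E] [CompleteSpace E]
    (F : Type w) [NormedAddCommGroup F] [NormedSpace ℝ F] [CompleteSpace F],
    ∃ W : Submodule ℝ (LipL0 X E F), (W : Set (LipL0 X E F)) = I X E F
  /-- The elementary operators belong to the class. -/
  elementary_mem : ∀ (X : Type u) [MetricSpace X] [Zero X]
    (E : Type v) [NormedAddCommGroup E] [NormedSpace ℝ E] [CompleteSpace E]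
    (F : Type w) [NormedAddCommGroup F] [NormedSpace ℝ F] [CompleteSpace F]
    (f : X → ℝ) (hf : IsLip0 f) (b : StrongDual ℝ E) (z : F), elementary f hf b z ∈ I X E F
  /-- The ideal property. -/
  sandwich_mem : ∀ (X X₀ : Type u) [MetricSpace X] [Zero X] [MetricSpace X₀] [Zero X₀]
    (E E₀ : Type v) [NormedAddCommGroup E] [NormedSpace ℝ E] [CompleteSpace E]
    [NormedAddCommGroup E₀] [NormedSpace ℝ E₀] [CompleteSpace E₀]
    (F F₀ : Type w) [NormedAddCommGroup F] [NormedSpace ℝ F] [CompleteSpace F]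
    [NormedAddCommGroup F₀] [NormedSpace ℝ F₀] [CompleteSpace F₀]
    (a : F₀ →L[ℝ] F) (T : LipL0 X₀ E₀ F₀) (f : X → X₀) (hf : IsLip0 f) (c : E →L[ℝ] E₀),
    T ∈ I X₀ E₀ F₀ → sandwich a T f hf c ∈ I X E F

/-- Banach Lip-linear ideals: `N` is the norm of the ideal `I`. -/
structure IsBanachLipLinearIdeal (I : LipLinearClass.{u, v, w})
    (N : LipLinearClassNorm.{u, v, w}) : Prop extends IsLipLinearIdeal I where
  /-- `N` is a norm on every component. -/
  norm_nonneg : ∀ (X : Type u) [MetricSpace X] [Zero X]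
    (E : Type v) [NormedAddCommGroup E] [NormedSpace ℝ E] [CompleteSpace E]
    (F : Type w) [NormedAddCommGroup F] [NormedSpace ℝ F] [CompleteSpace F],
    ∀ T ∈ I X E F, 0 ≤ N X E F T
  norm_eq_zero : ∀ (X : Type u) [MetricSpace X] [Zero X]
    (E : Type v) [NormedAddCommGroup E] [NormedSpace ℝ E] [CompleteSpace E]
    (F : Type w) [NormedAddCommGroup F] [NormedSpace ℝ F] [CompleteSpace F],
    ∀ T ∈ I X E F, N X E F T = 0 ↔ T = 0
  norm_smul : ∀ (X : Type u) [MetricSpace X] [Zero X]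
    (E : Type v) [NormedAddCommGroup E] [NormedSpace ℝ E] [CompleteSpace E]
    (F : Type w) [NormedAddCommGroup F] [NormedSpace ℝ F] [CompleteSpace F],
    ∀ (r : ℝ), ∀ T ∈ I X E F, N X E F (r • T) = |r| * N X E F T
  norm_add_le : ∀ (X : Type u) [MetricSpace X] [Zero X]
    (E : Type v) [NormedAddCommGroup E] [NormedSpace ℝ E] [CompleteSpace E]
    (F : Type w) [NormedAddCommGroup F] [NormedSpace ℝ F] [CompleteSpace F],
    ∀ S ∈ I X E F, ∀ T ∈ I X E F, N X E F (S + T) ≤ N X E F S + N X E F T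
  /-- Every component is complete for `N`. -/
  complete : ∀ (X : Type u) [MetricSpace X] [Zero X]
    (E : Type v) [NormedAddCommGroup E] [NormedSpace ℝ E] [CompleteSpace E]
    (F : Type w) [NormedAddCommGroup F] [NormedSpace ℝ F] [CompleteSpace F]
    (T : ℕ → LipL0 X E F), (∀ k, T k ∈ I X E F) →
    (∀ ε : ℝ, 0 < ε → ∃ M, ∀ k ≥ M, ∀ l ≥ M, N X E F (T k - T l) < ε) →
    ∃ S ∈ I X E F, Filter.Tendsto (fun k => N X E F (T k - S)) Filter.atTop (nhds 0)
  lipLNorm_le : ∀ (X : Type u) [MetricSpace X] [Zero X]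
    (E : Type v) [NormedAddCommGroup E] [NormedSpace ℝ E] [CompleteSpace E]
    (F : Type w) [NormedAddCommGroup F] [NormedSpace ℝ F] [CompleteSpace F],
    ∀ T ∈ I X E F, lipLNorm T ≤ N X E F T
  norm_mulReal : N (ULift.{u} ℝ) (ULift.{v} ℝ) (ULift.{w} ℝ) mulReal = 1
  norm_sandwich_le : ∀ (X X₀ : Type u) [MetricSpace X] [Zero X] [MetricSpace X₀] [Zero X₀]
    (E E₀ : Type v) [NormedAddCommGroup E] [NormedSpace ℝ E] [CompleteSpace E]
    [NormedAddCommGroup E₀] [NormedSpace ℝ E₀] [CompleteSpace E₀]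
    (F F₀ : Type w) [NormedAddCommGroup F] [NormedSpace ℝ F] [CompleteSpace F]
    [NormedAddCommGroup F₀] [NormedSpace ℝ F₀] [CompleteSpace F₀]
    (a : F₀ →L[ℝ] F) (T : LipL0 X₀ E₀ F₀) (f : X → X₀) (hf : IsLip0 f) (c : E →L[ℝ] E₀),
    T ∈ I X₀ E₀ F₀ →
      N X E F (sandwich a T f hf c) ≤ ‖a‖ * N X₀ E₀ F₀ T * lipNorm f * ‖c‖

end LipLinear

end

noncomputable section

namespace LipLinear

universe u v w t

/-! ### Finite `ℓ_p` sums -/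

/-! The engine is linearization. Each point `(x, e)` is sent to its evaluation `φ ↦ φ(x, e)` on the
unit ball of the scalar Lip-linear maps; the closed span of these evaluations in the space of
bounded functions on that ball is a Banach space `G`, and `(x, e) ↦` evaluation is Lip-linear with
constant at most 1. Each `φ` in the ball is a coordinate, hence a functional on `G` of norm at most
1.

Since `T` is linear in `e` and vanishes at the base point, `r T(x, e) = T(x, r e) - T(0, r e)`. So
every linear combination of values of `T` is a sum of differences as in the definition of factorable
strong summability, and the defining inequality for `T` is a `p`-summing inequality, with the same
constant, for the linear map `a` that sends evaluations to values of `T`. The case `n = 1` bounds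
`a`, density extends it to `G`, and continuity extends the summing inequality
(`FactStrongBound.exists_factorization`). Conversely, if `T = a ∘ S`, then for `f` in the dual ball
`f ∘ S` is a scalar Lip-linear map with constant at most `LipL(S)`, so the `p`-summing inequality
for `a` gives the one for `T` (`PSummingBound.factStrongBound`). The two directions together give
equality of classes and of norms.

The ideal axioms are read off the defining inequality: one pair of points gives `LipL(T) ≤ π(T)`,
composing test maps with `(f, c)` gives the ideal inequality, and completeness follows by pointwise
limits. -/

/-- Makes each infimum that defines a norm an admissible constant itself. Nonemptiness matters
because `sInf ∅ = 0`; when `s = 0` division is impossible, but any single `C` already gives `L ≤ 0`.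
-/
theorem le_sInf_mul {A : Set ℝ} {L s : ℝ} (hA : A.Nonempty) (hs : 0 ≤ s)
    (h : ∀ C ∈ A, L ≤ C * s) : L ≤ sInf A * s := by
  rcases hs.eq_or_lt with rfl | hs
  · obtain ⟨C, hC⟩ := hA
    simpa using h C hC
  · rw [← div_le_iff₀ hs]
    exact le_csInf hA fun C hC => (div_le_iff₀ hs).2 (h C hC)

theorem bddBelow_nonneg (P : ℝ → Prop) : BddBelow {C : ℝ | 0 ≤ C ∧ P C} :=
  ⟨0, fun _ h => h.1⟩

section LpSum

variable {ι : Type*} [Fintype ι] {F : Type*} [NormedAddCommGroup F]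

/-- The `ℓ_p` norm of a finite family. -/
def lpSum (p : ℝ) (a : ι → F) : ℝ := (∑ i, ‖a i‖ ^ p) ^ (1 / p)

theorem lpSum_nonneg (p : ℝ) (a : ι → F) : 0 ≤ lpSum p a :=
  Real.rpow_nonneg (Finset.sum_nonneg fun _ _ => Real.rpow_nonneg (norm_nonneg _) _) _

theorem lpSum_mono {G : Type*} [NormedAddCommGroup G] {p : ℝ} (hp : 1 ≤ p) {a : ι → F} {b : ι → G}
    (h : ∀ i, ‖a i‖ ≤ ‖b i‖) : lpSum p a ≤ lpSum p b := by
  have hp0 : 0 ≤ p := by linarith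
  exact Real.rpow_le_rpow (Finset.sum_nonneg fun _ _ => Real.rpow_nonneg (norm_nonneg _) _)
    (Finset.sum_le_sum fun i _ => Real.rpow_le_rpow (norm_nonneg _) (h i) hp0) (by positivity)

theorem lpSum_add_le {p : ℝ} (hp : 1 ≤ p) (a b : ι → F) :
    lpSum p (fun i => a i + b i) ≤ lpSum p a + lpSum p b := by
  have hp0 : 0 ≤ p := by linarith
  refine le_trans ?_ (Real.Lp_add_le_of_nonneg Finset.univ hp (f := fun i => ‖a i‖)
    (g := fun i => ‖b i‖) (fun i _ => norm_nonneg _) (fun i _ => norm_nonneg _))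
  exact Real.rpow_le_rpow (Finset.sum_nonneg fun _ _ => Real.rpow_nonneg (norm_nonneg _) _)
    (Finset.sum_le_sum fun i _ => Real.rpow_le_rpow (norm_nonneg _) (norm_add_le _ _) hp0)
    (by positivity)

theorem lpSum_smul [NormedSpace ℝ F] {p : ℝ} (hp : 1 ≤ p) (r : ℝ) (a : ι → F) :
    lpSum p (fun i => r • a i) = |r| * lpSum p a := by
  have hp0 : p ≠ 0 := by linarith
  unfold lpSum
  simp only [norm_smul, Real.norm_eq_abs]
  simp only [Real.mul_rpow (abs_nonneg r) (norm_nonneg _)]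
  rw [← Finset.mul_sum, Real.mul_rpow (by positivity) (by positivity), ← Real.rpow_mul (abs_nonneg r),
    mul_one_div_cancel hp0, Real.rpow_one]

theorem lpSum_unique {p : ℝ} (hp : 1 ≤ p) [Unique ι] (a : ι → F) : lpSum p a = ‖a default‖ := by
  have hp0 : p ≠ 0 := by linarith
  simp only [lpSum, Fintype.sum_unique]
  rw [← Real.rpow_mul (norm_nonneg _), mul_one_div_cancel hp0, Real.rpow_one]

theorem lpSum_map_le {G : Type*} [NormedAddCommGroup G] [NormedSpace ℝ F] [NormedSpace ℝ G]
    {p : ℝ} (hp : 1 ≤ p) (u : F →L[ℝ] G) (a : ι → F) :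
    lpSum p (fun i => u (a i)) ≤ ‖u‖ * lpSum p a := by
  calc lpSum p (fun i => u (a i)) ≤ lpSum p (fun i => ‖u‖ • a i) :=
        lpSum_mono hp fun i => by
          rw [norm_smul, norm_norm]; exact u.le_opNorm _
    _ = ‖u‖ * lpSum p a := by rw [lpSum_smul hp, abs_of_nonneg (norm_nonneg _)]

theorem continuous_lpSum {p : ℝ} (hp : 1 ≤ p) :
    Continuous (lpSum p : (ι → F) → ℝ) := by
  have hp0 : 0 ≤ p := by linarith
  unfold lpSum
  refine Continuous.rpow_const (continuous_finsetSum _ fun i _ => ?_) fun _ => Or.inr (by positivity)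
  exact Continuous.rpow_const (by fun_prop) fun _ => Or.inr hp0

end LpSum

/-! ### The norm `LipL` -/

/-- The least Lipschitz constant is a Lipschitz constant. -/
theorem dist_le_lipNorm {X Y : Type*} [MetricSpace X] [MetricSpace Y] {f : X → Y}
    (hf : ∃ K : NNReal, LipschitzWith K f) (x y : X) :
    dist (f x) (f y) ≤ lipNorm f * dist x y := by
  obtain ⟨K, hK⟩ := hf
  exact le_sInf_mul ⟨K, K.2, fun x y => hK.dist_le_mul x y⟩ dist_nonneg fun C hC => hC.2 x y

theorem lipNorm_nonneg {X Y : Type*} [MetricSpace X] [MetricSpace Y] (f : X → Y) :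
    0 ≤ lipNorm f :=
  Real.sInf_nonneg fun _ h => h.1

section LipLNorm

variable {X : Type u} [MetricSpace X] [Zero X]
  {E : Type v} [NormedAddCommGroup E] [NormedSpace ℝ E]
  {F : Type w} [NormedAddCommGroup F] [NormedSpace ℝ F]

theorem lipLNorm_nonneg (T : LipL0 X E F) : 0 ≤ lipLNorm T :=
  Real.sInf_nonneg fun _ h => h.1

theorem norm_sub_le_lipLNorm (T : LipL0 X E F) (x y : X) (e : E) :
    ‖T.1 (x, e) - T.1 (y, e)‖ ≤ lipLNorm T * dist x y * ‖e‖ := by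
  rw [mul_assoc]
  refine le_sInf_mul ?_ (by positivity) fun C hC => ?_
  · obtain ⟨C, hC⟩ := T.2.2.1
    exact ⟨C, hC⟩
  · rw [← mul_assoc]; exact hC.2 x y e

theorem lipLNorm_le_of_forall {T : LipL0 X E F} {C : ℝ} (hC : 0 ≤ C)
    (h : ∀ x y e, ‖T.1 (x, e) - T.1 (y, e)‖ ≤ C * dist x y * ‖e‖) : lipLNorm T ≤ C :=
  csInf_le (bddBelow_nonneg _) ⟨hC, h⟩

theorem eq_zero_of_lipLNorm_le_zero {T : LipL0 X E F} (h : lipLNorm T ≤ 0) : T = 0 := by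
  ext ⟨x, e⟩
  have h1 := norm_sub_le_lipLNorm T x 0 e
  rw [T.2.2.2 e, sub_zero] at h1
  have : ‖T.1 (x, e)‖ ≤ 0 := h1.trans <| by
    rw [mul_assoc]; exact mul_nonpos_of_nonpos_of_nonneg h (by positivity)
  simpa using this

theorem lipLNorm_smul_le (r : ℝ) (T : LipL0 X E F) : lipLNorm (r • T) ≤ |r| * lipLNorm T := by
  refine lipLNorm_le_of_forall (mul_nonneg (abs_nonneg r) (lipLNorm_nonneg T)) fun x y e => ?_
  have h : (r • T).1 (x, e) - (r • T).1 (y, e) = r • (T.1 (x, e) - T.1 (y, e)) := by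
    rw [smul_sub]; rfl
  rw [h, norm_smul, Real.norm_eq_abs, mul_assoc, mul_assoc, ← mul_assoc (lipLNorm T)]
  exact mul_le_mul_of_nonneg_left (norm_sub_le_lipLNorm T x y e) (abs_nonneg r)

theorem lipLNorm_zero : lipLNorm (0 : LipL0 X E F) = 0 :=
  le_antisymm (lipLNorm_le_of_forall le_rfl fun x y e => by simp) (lipLNorm_nonneg _)

theorem lipLNorm_sandwich_le {X₀ : Type u} [MetricSpace X₀] [Zero X₀]
    {E₀ : Type v} [NormedAddCommGroup E₀] [NormedSpace ℝ E₀]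
    {F₀ : Type w} [NormedAddCommGroup F₀] [NormedSpace ℝ F₀]
    (a : F₀ →L[ℝ] F) (T : LipL0 X₀ E₀ F₀) (f : X → X₀) (hf : IsLip0 f) (c : E →L[ℝ] E₀) :
    lipLNorm (sandwich a T f hf c) ≤ ‖a‖ * lipLNorm T * lipNorm f * ‖c‖ := by
  have hT := lipLNorm_nonneg T
  have hf0 := lipNorm_nonneg f
  refine lipLNorm_le_of_forall (by positivity) fun x y e => ?_
  calc ‖a (T.1 (f x, c e)) - a (T.1 (f y, c e))‖ = ‖a (T.1 (f x, c e) - T.1 (f y, c e))‖ := by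
        rw [map_sub]
    _ ≤ ‖a‖ * (lipLNorm T * dist (f x) (f y) * ‖c e‖) :=
        a.le_opNorm_of_le (norm_sub_le_lipLNorm T _ _ _)
    _ ≤ ‖a‖ * (lipLNorm T * (lipNorm f * dist x y) * (‖c‖ * ‖e‖)) := by
        gcongr
        · exact dist_le_lipNorm hf.1 x y
        · exact c.le_opNorm e
    _ = ‖a‖ * lipLNorm T * lipNorm f * ‖c‖ * dist x y * ‖e‖ := by ring

/-- The composite of a Lip-linear operator with a bounded linear operator, with the target spaces
in arbitrary universes. -/
def postcomp {G : Type t} [NormedAddCommGroup G] [NormedSpace ℝ G] (a : F →L[ℝ] G)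
    (T : LipL0 X E F) : LipL0 X E G :=
  ⟨fun q => a (T.1 q), fun x => ⟨fun b c => by simp only [(T.2.1 x).map_add b c, map_add],
      fun r b => by simp only [(T.2.1 x).map_smul r b, map_smul]⟩,
    ⟨‖a‖ * lipLNorm T, mul_nonneg (norm_nonneg a) (lipLNorm_nonneg T), fun x y e => by
      rw [← map_sub, mul_assoc, mul_assoc, ← mul_assoc (lipLNorm T)]
      exact a.le_opNorm_of_le (norm_sub_le_lipLNorm T x y e)⟩,
    fun e => by simp only [T.2.2.2 e, map_zero]⟩

theorem lipLNorm_postcomp_le {G : Type t} [NormedAddCommGroup G] [NormedSpace ℝ G] (a : F →L[ℝ] G)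
    (T : LipL0 X E F) : lipLNorm (postcomp a T) ≤ ‖a‖ * lipLNorm T := by
  refine lipLNorm_le_of_forall (mul_nonneg (norm_nonneg a) (lipLNorm_nonneg T)) fun x y e => ?_
  change ‖a _ - a _‖ ≤ _
  rw [← map_sub, mul_assoc, mul_assoc, ← mul_assoc (lipLNorm T)]
  exact a.le_opNorm_of_le (norm_sub_le_lipLNorm T x y e)

/-! ### The weak norms and the summing inequalities -/

/-- The map `T ↦ ∑ j, (T (x j, e j) - T (y j, e j))`. -/
def diffSum (F : Type w) [NormedAddCommGroup F] [NormedSpace ℝ F] {κ : Type*} [Fintype κ]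
    (x y : κ → X) (e : κ → E) : LipL0 X E F →ₗ[ℝ] F where
  toFun T := ∑ j, (T.1 (x j, e j) - T.1 (y j, e j))
  map_add' S T := by
    rw [← Finset.sum_add_distrib]
    refine Finset.sum_congr rfl fun j _ => ?_
    change S.1 _ + T.1 _ - (S.1 _ + T.1 _) = _
    abel
  map_smul' r T := by
    rw [Finset.smul_sum]
    refine Finset.sum_congr rfl fun j _ => ?_
    rw [smul_sub]; rfl

theorem diffSum_postcomp {G : Type t} [NormedAddCommGroup G] [NormedSpace ℝ G] {κ : Type*}
    [Fintype κ] (x y : κ → X) (e : κ → E) (a : F →L[ℝ] G) (T : LipL0 X E F) :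
    diffSum G x y e (postcomp a T) = a (diffSum F x y e T) := by
  simp only [diffSum, postcomp, LinearMap.coe_mk, AddHom.coe_mk, map_sum, map_sub]

theorem diffSum_comp_equiv {κ κ' : Type*} [Fintype κ] [Fintype κ'] (σ : κ' ≃ κ) (x y : κ → X)
    (e : κ → E) (T : LipL0 X E F) :
    diffSum F (x ∘ σ) (y ∘ σ) (e ∘ σ) T = diffSum F x y e T :=
  Equiv.sum_comp σ fun j => T.1 (x j, e j) - T.1 (y j, e j)

theorem norm_diffSum_le {κ : Type*} [Fintype κ] (x y : κ → X) (e : κ → E) (T : LipL0 X E F) :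
    ‖diffSum F x y e T‖ ≤ lipLNorm T * ∑ j, dist (x j) (y j) * ‖e j‖ := by
  rw [Finset.mul_sum]
  refine (norm_sum_le _ _).trans (Finset.sum_le_sum fun j _ => ?_)
  rw [← mul_assoc]
  exact norm_sub_le_lipLNorm T _ _ _

variable (X E) in
/-- The closed unit ball of `LipL₀(X × E; ℝ)`. -/
abbrev UnitBall : Type (max u v) := {φ : LipL0 X E ℝ // lipLNorm φ ≤ 1}

instance : Nonempty (UnitBall X E) := ⟨0, by rw [lipLNorm_zero]; exact zero_le_one⟩

/-- The right-hand side of the inequality that defines factorable strong `p`-summability. -/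
def weakDiff (p : ℝ) {ι κ : Type*} [Fintype ι] [Fintype κ] (x y : ι → κ → X) (e : ι → κ → E) : ℝ :=
  ⨆ φ : UnitBall X E, lpSum p fun i => diffSum ℝ (x i) (y i) (e i) φ.1

theorem factStrongBound_iff {p : ℝ} {T : LipL0 X E F} {C : ℝ} :
    FactStrongBound p T C ↔ ∀ (n m : ℕ) (x y : Fin n → Fin m → X) (e : Fin n → Fin m → E),
      lpSum p (fun i => diffSum F (x i) (y i) (e i) T) ≤ C * weakDiff p x y e :=
  Iff.rfl

variable {ι κ : Type*} [Fintype ι] [Fintype κ]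

theorem weakDiff_nonneg (p : ℝ) (x y : ι → κ → X) (e : ι → κ → E) : 0 ≤ weakDiff p x y e :=
  Real.iSup_nonneg fun _ => lpSum_nonneg _ _

theorem le_weakDiff {p : ℝ} (hp : 1 ≤ p) (x y : ι → κ → X) (e : ι → κ → E) {φ : LipL0 X E ℝ}
    (hφ : lipLNorm φ ≤ 1) :
    lpSum p (fun i => diffSum ℝ (x i) (y i) (e i) φ) ≤ weakDiff p x y e := by
  -- The explicit upper bound is needed because the supremum of an unbounded real family is 0 by
  -- convention.
  refine le_ciSup (f := fun φ : UnitBall X E => lpSum p fun i => diffSum ℝ (x i) (y i) (e i) φ.1)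
    ⟨lpSum p fun i => ∑ j, dist (x i j) (y i j) * ‖e i j‖, ?_⟩ ⟨φ, hφ⟩
  rintro _ ⟨ψ, rfl⟩
  refine lpSum_mono hp fun i => (norm_diffSum_le _ _ _ _).trans ?_
  rw [Real.norm_of_nonneg (by positivity)]
  exact mul_le_of_le_one_left (by positivity) ψ.2

/-- Homogeneity: `K⁻¹ • φ` lies in the unit ball, and `K = 0` forces `φ = 0`. -/
theorem le_mul_weakDiff {p : ℝ} (hp : 1 ≤ p) (x y : ι → κ → X) (e : ι → κ → E) {φ : LipL0 X E ℝ}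
    {K : ℝ} (hφ : lipLNorm φ ≤ K) :
    lpSum p (fun i => diffSum ℝ (x i) (y i) (e i) φ) ≤ K * weakDiff p x y e := by
  rcases ((lipLNorm_nonneg φ).trans hφ).eq_or_lt with rfl | hK
  · rw [eq_zero_of_lipLNorm_le_zero hφ]
    have := lpSum_smul hp 0 (fun _ : ι => (0 : ℝ))
    simp only [smul_zero, abs_zero, zero_mul] at this
    simp [this]
  · have h : lipLNorm (K⁻¹ • φ) ≤ 1 := (lipLNorm_smul_le _ _).trans <| by
      rw [abs_of_pos (inv_pos.2 hK), inv_mul_le_iff₀ hK, mul_one]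
      exact hφ
    have h2 := le_weakDiff hp x y e h
    simp only [map_smul] at h2
    rwa [lpSum_smul hp, abs_of_pos (inv_pos.2 hK), inv_mul_le_iff₀ hK] at h2

/-- Reindexing along `κ ≃ Fin m` frees the inner index, so that `Unit` and finite sets of points can
serve as index types. -/
theorem FactStrongBound.le_weakDiff {p : ℝ} {T : LipL0 X E F} {C : ℝ} (h : FactStrongBound p T C)
    {n : ℕ} (x y : Fin n → κ → X) (e : Fin n → κ → E) :
    lpSum p (fun i => diffSum F (x i) (y i) (e i) T) ≤ C * weakDiff p x y e := by
  have h1 := factStrongBound_iff.1 h n (Fintype.card κ)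
    (fun i => x i ∘ (Fintype.equivFin κ).symm) (fun i => y i ∘ (Fintype.equivFin κ).symm)
    (fun i => e i ∘ (Fintype.equivFin κ).symm)
  simp only [diffSum_comp_equiv, weakDiff] at h1
  exact h1

theorem factStrongNorm_nonneg (p : ℝ) (T : LipL0 X E F) : 0 ≤ factStrongNorm p T :=
  Real.sInf_nonneg fun _ h => h.1

theorem factStrongNorm_le {p : ℝ} {T : LipL0 X E F} {C : ℝ} (hC : 0 ≤ C)
    (h : FactStrongBound p T C) : factStrongNorm p T ≤ C :=
  csInf_le (bddBelow_nonneg _) ⟨hC, h⟩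

theorem factStrongBound_factStrongNorm {p : ℝ} {T : LipL0 X E F} (hT : T ∈ FactStrong p X E F) :
    FactStrongBound p T (factStrongNorm p T) := fun n m x y e =>
  le_sInf_mul hT (weakDiff_nonneg p x y e) fun _ hC => hC.2 n m x y e

/-- The defining inequality for a single pair of points: each test map `φ` contributes at most `d(x,
y) ‖e‖`. -/
theorem FactStrongBound.norm_sub_le {p : ℝ} (hp : 1 ≤ p) {T : LipL0 X E F} {C : ℝ} (hC : 0 ≤ C)
    (h : FactStrongBound p T C) (x y : X) (e : E) :
    ‖T.1 (x, e) - T.1 (y, e)‖ ≤ C * dist x y * ‖e‖ := by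
  have h1 := h.le_weakDiff (n := 1) (fun _ (_ : Unit) => x) (fun _ _ => y) (fun _ _ => e)
  have key : ∀ {G : Type _} [NormedAddCommGroup G] [NormedSpace ℝ G] (S : LipL0 X E G),
      diffSum G (fun _ : Unit => x) (fun _ => y) (fun _ => e) S
        = S.1 (x, e) - S.1 (y, e) := fun S => by simp [diffSum]
  rw [lpSum_unique hp, key] at h1
  refine h1.trans ?_
  rw [mul_assoc]
  refine mul_le_mul_of_nonneg_left (ciSup_le fun φ => ?_) hC
  rw [lpSum_unique hp]
  refine (norm_diffSum_le _ _ _ _).trans ?_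
  simpa using mul_le_of_le_one_left (by positivity : 0 ≤ dist x y * ‖e‖) φ.2

theorem lipLNorm_le_factStrongNorm {p : ℝ} (hp : 1 ≤ p) {T : LipL0 X E F}
    (hT : T ∈ FactStrong p X E F) : lipLNorm T ≤ factStrongNorm p T :=
  lipLNorm_le_of_forall (factStrongNorm_nonneg p T)
    ((factStrongBound_factStrongNorm hT).norm_sub_le hp (factStrongNorm_nonneg p T))

/-! ### Vector space structure and norm axioms -/

theorem FactStrongBound.zero {p : ℝ} (hp : 1 ≤ p) : FactStrongBound p (0 : LipL0 X E F) 0 := by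
  refine factStrongBound_iff.2 fun n m x y e => ?_
  have := lpSum_smul hp 0 (fun _ : Fin n => (0 : F))
  simp only [smul_zero, abs_zero, zero_mul] at this
  simp [this]

theorem FactStrongBound.add {p : ℝ} (hp : 1 ≤ p) {S T : LipL0 X E F} {C D : ℝ}
    (hS : FactStrongBound p S C) (hT : FactStrongBound p T D) :
    FactStrongBound p (S + T) (C + D) := by
  refine factStrongBound_iff.2 fun n m x y e => ?_
  simp only [map_add]
  rw [add_mul]
  exact (lpSum_add_le hp _ _).trans (add_le_add (hS n m x y e) (hT n m x y e))

theorem FactStrongBound.smul {p : ℝ} (hp : 1 ≤ p) {T : LipL0 X E F} {C : ℝ} (r : ℝ)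
    (hT : FactStrongBound p T C) : FactStrongBound p (r • T) (|r| * C) := by
  refine factStrongBound_iff.2 fun n m x y e => ?_
  simp only [map_smul]
  rw [lpSum_smul hp, mul_assoc]
  exact mul_le_mul_of_nonneg_left (hT n m x y e) (abs_nonneg r)

theorem factStrongNorm_add_le {p : ℝ} (hp : 1 ≤ p) {S T : LipL0 X E F}
    (hS : S ∈ FactStrong p X E F) (hT : T ∈ FactStrong p X E F) :
    factStrongNorm p (S + T) ≤ factStrongNorm p S + factStrongNorm p T :=
  factStrongNorm_le (add_nonneg (factStrongNorm_nonneg p S) (factStrongNorm_nonneg p T))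
    ((factStrongBound_factStrongNorm hS).add hp (factStrongBound_factStrongNorm hT))

variable (X E F) in
/-- The class of factorable strongly `p`-summing operators as a subspace. -/
def factStrongSubmodule {p : ℝ} (hp : 1 ≤ p) : Submodule ℝ (LipL0 X E F) where
  carrier := FactStrong p X E F
  zero_mem' := ⟨0, le_rfl, FactStrongBound.zero hp⟩
  add_mem' := by
    rintro S T ⟨C, hC, hS⟩ ⟨D, hD, hT⟩
    exact ⟨C + D, add_nonneg hC hD, hS.add hp hT⟩
  smul_mem' := by
    rintro r T ⟨C, hC, hT⟩
    exact ⟨|r| * C, mul_nonneg (abs_nonneg r) hC, hT.smul hp r⟩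

theorem factStrongNorm_smul_le {p : ℝ} (hp : 1 ≤ p) {T : LipL0 X E F} (r : ℝ)
    (hT : T ∈ FactStrong p X E F) : factStrongNorm p (r • T) ≤ |r| * factStrongNorm p T :=
  factStrongNorm_le (mul_nonneg (abs_nonneg r) (factStrongNorm_nonneg p T))
    ((factStrongBound_factStrongNorm hT).smul hp r)

theorem factStrongNorm_smul {p : ℝ} (hp : 1 ≤ p) {T : LipL0 X E F} (r : ℝ)
    (hT : T ∈ FactStrong p X E F) : factStrongNorm p (r • T) = |r| * factStrongNorm p T := by
  refine le_antisymm (factStrongNorm_smul_le hp r hT) ?_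
  rcases eq_or_ne r 0 with rfl | hr
  · rw [abs_zero, zero_mul]; exact factStrongNorm_nonneg _ _
  · have h := factStrongNorm_smul_le hp r⁻¹ ((factStrongSubmodule X E F hp).smul_mem r hT)
    rwa [inv_smul_smul₀ hr, abs_inv, ← div_eq_inv_mul, le_div_iff₀' (abs_pos.2 hr)] at h

theorem factStrongNorm_eq_zero {p : ℝ} (hp : 1 ≤ p) {T : LipL0 X E F}
    (hT : T ∈ FactStrong p X E F) : factStrongNorm p T = 0 ↔ T = 0 := by
  constructor
  · intro h
    exact eq_zero_of_lipLNorm_le_zero ((lipLNorm_le_factStrongNorm hp hT).trans h.le)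
  · rintro rfl
    exact le_antisymm (factStrongNorm_le le_rfl (FactStrongBound.zero hp))
      (factStrongNorm_nonneg _ _)

end LipLNorm

/-! ### The ideal properties -/

section Ideal

variable {X : Type u} [MetricSpace X] [Zero X]
  {E : Type v} [NormedAddCommGroup E] [NormedSpace ℝ E]
  {F : Type w} [NormedAddCommGroup F] [NormedSpace ℝ F]

/-- A scalar Lip-linear map is, up to scaling, one of the test maps in the supremum. This settles
every operator that factors through `ℝ`: the elementary ones and the product map. -/
theorem FactStrongBound.postcomp_real {p : ℝ} (hp : 1 ≤ p) (a : ℝ →L[ℝ] F) (φ : LipL0 X E ℝ) :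
    FactStrongBound p (postcomp a φ) (‖a‖ * lipLNorm φ) := by
  refine factStrongBound_iff.2 fun n m x y e => ?_
  simp only [diffSum_postcomp]
  rw [mul_assoc]
  exact (lpSum_map_le hp a _).trans
    (mul_le_mul_of_nonneg_left (le_mul_weakDiff hp x y e le_rfl) (norm_nonneg a))

theorem elementary_mem_factStrong {p : ℝ} (hp : 1 ≤ p) (f : X → ℝ) (hf : IsLip0 f)
    (b : StrongDual ℝ E) (z : F) : elementary f hf b z ∈ FactStrong p X E F := by
  have h : elementary f hf b z
      = postcomp (ContinuousLinearMap.toSpanSingleton ℝ z) (elementary f hf b (1 : ℝ)) := by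
    ext q
    simp [elementary, postcomp]
  rw [h]
  exact ⟨_, mul_nonneg (norm_nonneg _) (lipLNorm_nonneg _), FactStrongBound.postcomp_real hp _ _⟩

section Sandwich

variable {X₀ : Type u} [MetricSpace X₀] [Zero X₀]
  {E₀ : Type v} [NormedAddCommGroup E₀] [NormedSpace ℝ E₀]
  {F₀ : Type w} [NormedAddCommGroup F₀] [NormedSpace ℝ F₀]

theorem diffSum_sandwich {κ : Type*} [Fintype κ] (x y : κ → X) (e : κ → E) (a : F₀ →L[ℝ] F)
    (T : LipL0 X₀ E₀ F₀) (f : X → X₀) (hf : IsLip0 f) (c : E →L[ℝ] E₀) :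
    diffSum F x y e (sandwich a T f hf c)
      = a (diffSum F₀ (fun j => f (x j)) (fun j => f (y j)) (fun j => c (e j)) T) := by
  simp only [diffSum, sandwich, LinearMap.coe_mk, AddHom.coe_mk, map_sum, map_sub]

/-- If `φ` is in the unit ball over `X₀ × E₀`, then `φ ∘ (f, c)` has constant at most `Lip(f) ‖c‖`
over `X × E`. -/
theorem weakDiff_comp_le {p : ℝ} (hp : 1 ≤ p) {ι κ : Type*} [Fintype ι] [Fintype κ]
    (x y : ι → κ → X) (e : ι → κ → E) (f : X → X₀) (hf : IsLip0 f) (c : E →L[ℝ] E₀) :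
    weakDiff p (fun i j => f (x i j)) (fun i j => f (y i j)) (fun i j => c (e i j))
      ≤ lipNorm f * ‖c‖ * weakDiff p x y e := by
  have hf0 := lipNorm_nonneg f
  refine ciSup_le fun φ => ?_
  have h : lipLNorm (sandwich (.id ℝ ℝ) φ.1 f hf c) ≤ lipNorm f * ‖c‖ := by
    refine (lipLNorm_sandwich_le _ _ _ _ _).trans ?_
    gcongr
    rw [ContinuousLinearMap.norm_id, one_mul]
    exact mul_le_of_le_one_left hf0 φ.2
  have h2 := le_mul_weakDiff hp x y e h
  simpa only [diffSum_sandwich, ContinuousLinearMap.id_apply] using h2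

theorem FactStrongBound.sandwich {p : ℝ} (hp : 1 ≤ p) {T : LipL0 X₀ E₀ F₀} {C : ℝ} (hC : 0 ≤ C)
    (hT : FactStrongBound p T C) (a : F₀ →L[ℝ] F) (f : X → X₀) (hf : IsLip0 f) (c : E →L[ℝ] E₀) :
    FactStrongBound p (sandwich a T f hf c) (‖a‖ * C * lipNorm f * ‖c‖) := by
  refine factStrongBound_iff.2 fun n m x y e => ?_
  simp only [diffSum_sandwich]
  refine (lpSum_map_le hp a _).trans ?_
  calc _ ≤ ‖a‖ * (C * (lipNorm f * ‖c‖ * weakDiff p x y e)) := by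
        gcongr
        exact (hT.le_weakDiff _ _ _).trans
          (mul_le_mul_of_nonneg_left (weakDiff_comp_le hp x y e f hf c) hC)
    _ = _ := by ring

end Sandwich

theorem factStrongNorm_mulReal {p : ℝ} (hp : 1 ≤ p) :
    mulReal.{u, v, w} ∈ FactStrong p _ _ _ ∧ factStrongNorm p mulReal.{u, v, w} = 1 := by
  let up : ℝ →L[ℝ] ULift.{w} ℝ :=
    (ContinuousLinearEquiv.ulift (R₁ := ℝ) (M₁ := ℝ)).symm.toContinuousLinearMap
  let down : ULift.{w} ℝ →L[ℝ] ℝ :=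
    (ContinuousLinearEquiv.ulift (R₁ := ℝ) (M₁ := ℝ)).toContinuousLinearMap
  have hup : ‖up‖ ≤ 1 := up.opNorm_le_bound zero_le_one fun r => by
    rw [one_mul]; exact le_of_eq rfl
  have hmul : mulReal.{u, v, w} = postcomp up (postcomp down mulReal.{u, v, w}) := rfl
  have hφ : lipLNorm (postcomp down mulReal.{u, v, w}) ≤ 1 :=
    lipLNorm_le_of_forall zero_le_one fun x y e => by
      change ‖x.down * e.down - y.down * e.down‖ ≤ _
      rw [one_mul, ← sub_mul, norm_mul, ULift.dist_eq, dist_eq_norm, ULift.norm_def]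
  have hb : FactStrongBound p mulReal.{u, v, w} (‖up‖ * lipLNorm (postcomp down mulReal.{u, v, w})) :=
    FactStrongBound.postcomp_real hp up (postcomp down mulReal.{u, v, w})
  have hn := mul_nonneg (norm_nonneg up) (lipLNorm_nonneg (postcomp down mulReal.{u, v, w}))
  have hmem : mulReal.{u, v, w} ∈ FactStrong p _ _ _ := ⟨_, hn, hb⟩
  refine ⟨hmem, le_antisymm ((factStrongNorm_le hn hb).trans
    (mul_le_one₀ hup (lipLNorm_nonneg _) hφ)) ?_⟩
  refine le_trans ?_ (lipLNorm_le_factStrongNorm hp hmem)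
  -- The points `x = 1`, `y = 0`, `e = 1` turn the Lipschitz estimate into `1 ≤ LipL`.
  have h := norm_sub_le_lipLNorm mulReal.{u, v, w} ⟨1⟩ ⟨0⟩ ⟨1⟩
  have h1 : mulReal.{u, v, w}.1 (⟨1⟩, ⟨1⟩) - mulReal.1 (⟨0⟩, ⟨1⟩) = (ULift.up 1) := by
    ext; simp [mulReal]
  rw [h1, ULift.dist_eq, ULift.norm_def, ULift.norm_def] at h
  simpa using h

/-! ### Completeness -/

open Filter Topology

/-- The norm dominates `LipL`, so a Cauchy sequence converges pointwise. Each instance of the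
summing inequality involves finitely many points, hence survives the limit with the Cauchy `ε` as
its constant. -/
theorem factStrong_complete {p : ℝ} (hp : 1 ≤ p) [CompleteSpace F] (T : ℕ → LipL0 X E F)
    (hT : ∀ k, T k ∈ FactStrong p X E F)
    (hc : ∀ ε : ℝ, 0 < ε → ∃ M, ∀ k ≥ M, ∀ l ≥ M, factStrongNorm p (T k - T l) < ε) :
    ∃ S ∈ FactStrong p X E F, Tendsto (fun k => factStrongNorm p (T k - S)) atTop (𝓝 0) := by
  have hsub : ∀ k l, T k - T l ∈ FactStrong p X E F := fun k l =>
    (factStrongSubmodule X E F hp).sub_mem (hT k) (hT l)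
  have hpt : ∀ q : X × E, ∃ z, Tendsto (fun k => (T k).1 q) atTop (𝓝 z) := by
    rintro ⟨x, e⟩
    refine cauchySeq_tendsto_of_complete (Metric.cauchySeq_iff.2 fun ε hε => ?_)
    -- The added 1 keeps the divisor positive when `x = 0` or `e = 0`.
    have hd : 0 < dist x 0 * ‖e‖ + 1 := by positivity
    obtain ⟨M, hM⟩ := hc (ε / (dist x 0 * ‖e‖ + 1)) (by positivity)
    refine ⟨M, fun k hk l hl => ?_⟩
    have h1 := norm_sub_le_lipLNorm (T k - T l) x 0 e
    rw [(T k - T l).2.2.2 e, sub_zero, mul_assoc] at h1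
    have h2 := (lipLNorm_le_factStrongNorm hp (hsub k l)).trans_lt (hM k hk l hl)
    rw [dist_eq_norm]
    calc ‖(T k).1 (x, e) - (T l).1 (x, e)‖ ≤ lipLNorm (T k - T l) * (dist x 0 * ‖e‖) := h1
      _ ≤ ε / (dist x 0 * ‖e‖ + 1) * (dist x 0 * ‖e‖) := by gcongr
      _ < ε / (dist x 0 * ‖e‖ + 1) * (dist x 0 * ‖e‖ + 1) := by
          gcongr; exact lt_add_one _
      _ = ε := div_mul_cancel₀ _ hd.ne'
  choose S hS using hpt
  have hlim : ∀ ε, 0 < ε → ∃ M, ∀ k ≥ M, ∀ (x y : X) (e : E),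
      ‖((T k).1 (x, e) - S (x, e)) - ((T k).1 (y, e) - S (y, e))‖ ≤ ε * dist x y * ‖e‖ := by
    intro ε hε
    obtain ⟨M, hM⟩ := hc ε hε
    refine ⟨M, fun k hk x y e => ?_⟩
    refine le_of_tendsto ((((hS (x, e)).const_sub ((T k).1 (x, e))).sub
      ((hS (y, e)).const_sub ((T k).1 (y, e)))).norm) ?_
    filter_upwards [eventually_ge_atTop M] with l hl
    have h1 := norm_sub_le_lipLNorm (T k - T l) x y e
    refine h1.trans ?_
    have h2 := (lipLNorm_le_factStrongNorm hp (hsub k l)).trans (hM k hk l hl).le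
    gcongr
  have hSmem : S ∈ LipL0 X E F := by
    refine ⟨fun x => ⟨fun a b => ?_, fun r a => ?_⟩, ?_, fun e => ?_⟩
    · refine tendsto_nhds_unique (hS (x, a + b)) (((hS (x, a)).add (hS (x, b))).congr fun k => ?_)
      exact (((T k).2.1 x).map_add a b).symm
    · refine tendsto_nhds_unique (hS (x, r • a)) (((hS (x, a)).const_smul r).congr fun k => ?_)
      exact (((T k).2.1 x).map_smul r a).symm
    · obtain ⟨M, hM⟩ := hlim 1 one_pos
      refine ⟨lipLNorm (T M) + 1, add_nonneg (lipLNorm_nonneg _) zero_le_one, fun x y e => ?_⟩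
      have h1 := norm_sub_le_lipLNorm (T M) x y e
      have h2 := hM M le_rfl x y e
      calc ‖S (x, e) - S (y, e)‖ = ‖((T M).1 (x, e) - (T M).1 (y, e))
            - (((T M).1 (x, e) - S (x, e)) - ((T M).1 (y, e) - S (y, e)))‖ := by
              congr 1; abel
        _ ≤ _ := norm_sub_le _ _
        _ ≤ _ := add_le_add h1 h2
        _ = _ := by ring
    · refine tendsto_nhds_unique (hS (0, e)) (tendsto_const_nhds.congr fun k => ?_)
      exact ((T k).2.2.2 e).symm
  have hbound : ∀ ε, 0 < ε → ∃ M, ∀ k ≥ M, FactStrongBound p (T k - ⟨S, hSmem⟩) ε := by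
    intro ε hε
    obtain ⟨M, hM⟩ := hc ε hε
    refine ⟨M, fun k hk => factStrongBound_iff.2 fun n m x y e => ?_⟩
    have ht : Tendsto (fun l => lpSum p fun i => diffSum F (x i) (y i) (e i) (T k - T l)) atTop
        (𝓝 (lpSum p fun i => diffSum F (x i) (y i) (e i) (T k - ⟨S, hSmem⟩))) := by
      refine ((continuous_lpSum hp).tendsto _).comp (tendsto_pi_nhds.2 fun i => ?_)
      change Tendsto (fun l => ∑ j, (((T k).1 (x i j, e i j) - (T l).1 (x i j, e i j))
        - ((T k).1 (y i j, e i j) - (T l).1 (y i j, e i j)))) atTop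
        (𝓝 (∑ j, (((T k).1 (x i j, e i j) - S (x i j, e i j))
        - ((T k).1 (y i j, e i j) - S (y i j, e i j)))))
      refine tendsto_finsetSum _ fun j _ => ?_
      exact ((hS (x i j, e i j)).const_sub ((T k).1 (x i j, e i j))).sub
        ((hS (y i j, e i j)).const_sub ((T k).1 (y i j, e i j)))
    refine le_of_tendsto ht ?_
    filter_upwards [eventually_ge_atTop M] with l hl
    exact (factStrongBound_factStrongNorm (hsub k l) n m x y e).trans
      (mul_le_mul_of_nonneg_right (hM k hk l hl).le (weakDiff_nonneg p x y e))
  refine ⟨⟨S, hSmem⟩, ?_, ?_⟩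
  -- The limit is `T M - (T M - S)`, a difference of two members of the subspace.
  · obtain ⟨M, hM⟩ := hbound 1 one_pos
    have h := (factStrongSubmodule X E F hp).sub_mem (hT M)
      (show T M - ⟨S, hSmem⟩ ∈ _ from ⟨1, zero_le_one, hM M le_rfl⟩)
    rwa [sub_sub_cancel] at h
  · refine Metric.tendsto_atTop.2 fun ε hε => ?_
    obtain ⟨M, hM⟩ := hbound (ε / 2) (half_pos hε)
    refine ⟨M, fun k hk => ?_⟩
    rw [Real.dist_0_eq_abs, abs_of_nonneg (factStrongNorm_nonneg _ _)]
    exact (factStrongNorm_le (half_pos hε).le (hM k hk)).trans_lt (half_lt_self hε)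

end Ideal

/-! ### `p`-summing operators -/

section PSumming

variable {G : Type t} [NormedAddCommGroup G] [NormedSpace ℝ G]
  {F : Type w} [NormedAddCommGroup F] [NormedSpace ℝ F]

/-- The weak `ℓ_p` norm of a finite family. -/
def weakLp {ι : Type*} [Fintype ι] (p : ℝ) (g : ι → G) : ℝ :=
  ⨆ f : {f : StrongDual ℝ G // ‖f‖ ≤ 1}, lpSum p fun i => f.1 (g i)

theorem pSummingBound_iff {p : ℝ} {a : G →L[ℝ] F} {C : ℝ} :
    PSummingBound p a C ↔
      ∀ (n : ℕ) (g : Fin n → G), lpSum p (fun i => a (g i)) ≤ C * weakLp p g :=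
  Iff.rfl

variable {ι : Type*} [Fintype ι]

instance : Nonempty {f : StrongDual ℝ G // ‖f‖ ≤ 1} := ⟨0, by simp⟩

theorem weakLp_nonneg (p : ℝ) (g : ι → G) : 0 ≤ weakLp p g :=
  Real.iSup_nonneg fun _ => lpSum_nonneg _ _

theorem lpSum_dual_le {p : ℝ} (hp : 1 ≤ p) (g : ι → G) {f : StrongDual ℝ G} (hf : ‖f‖ ≤ 1) :
    lpSum p (fun i => f (g i)) ≤ lpSum p g :=
  (lpSum_map_le hp f g).trans (mul_le_of_le_one_left (lpSum_nonneg p g) hf)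

theorem le_weakLp {p : ℝ} (hp : 1 ≤ p) (g : ι → G) {f : StrongDual ℝ G} (hf : ‖f‖ ≤ 1) :
    lpSum p (fun i => f (g i)) ≤ weakLp p g := by
  refine le_ciSup (f := fun f : {f : StrongDual ℝ G // ‖f‖ ≤ 1} => lpSum p fun i => f.1 (g i))
    ⟨lpSum p g, ?_⟩ ⟨f, hf⟩
  rintro _ ⟨h, rfl⟩
  exact lpSum_dual_le hp g h.2

theorem weakLp_le_add {p : ℝ} (hp : 1 ≤ p) (g h : ι → G) :
    weakLp p g ≤ weakLp p h + lpSum p (fun i => g i - h i) := by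
  refine ciSup_le fun f => ?_
  have h1 := lpSum_add_le hp (fun i => f.1 (h i)) (fun i => f.1 (g i - h i))
  simp only [← map_add, add_sub_cancel] at h1
  exact h1.trans (add_le_add (le_weakLp hp h f.2) (lpSum_dual_le hp _ f.2))

theorem pSummingNorm_nonneg (p : ℝ) (a : G →L[ℝ] F) : 0 ≤ pSummingNorm p a :=
  Real.sInf_nonneg fun _ h => h.1

theorem pSummingBound_pSummingNorm {p : ℝ} {a : G →L[ℝ] F} (ha : a ∈ PSumming p G F) :
    PSummingBound p a (pSummingNorm p a) := fun n g =>
  le_sInf_mul ha (weakLp_nonneg p g) fun _ hC => hC.2 n g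

/-- The summing inequality extends from a dense subset by continuity. -/
theorem PSummingBound.of_denseRange {p : ℝ} (hp : 1 ≤ p) {D : Type*} {A : D → G} (hA : DenseRange A)
    {a : G →L[ℝ] F} {C : ℝ} (hC : 0 ≤ C)
    (h : ∀ (n : ℕ) (c : Fin n → D), lpSum p (fun i => a (A (c i))) ≤ C * weakLp p (A ∘ c)) :
    PSummingBound p a C := by
  refine pSummingBound_iff.2 fun n g => ?_
  -- The weak norm of `q` is replaced by that of the fixed `g` plus the distance from `q` to `g`.
  -- The right side is then visibly continuous in `q`, and `q = g` recovers the claim.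
  have key : ∀ q : Fin n → G, lpSum p (fun i => a (q i))
      ≤ C * (weakLp p g + lpSum p (fun i => q i - g i)) := by
    have hd : DenseRange (Pi.map fun _ : Fin n => A) := DenseRange.piMap fun _ => hA
    refine fun q => hd.induction_on (p := fun q : Fin n → G => lpSum p (fun i => a (q i))
      ≤ C * (weakLp p g + lpSum p (fun i => q i - g i))) q ?_ fun c => ?_
    · have h1 : Continuous fun q : Fin n → G => lpSum p (fun i => a (q i)) :=
        (continuous_lpSum hp).comp (by fun_prop)
      have h2 : Continuous fun q : Fin n → G => lpSum p (fun i => q i - g i) :=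
        (continuous_lpSum hp).comp (by fun_prop)
      exact isClosed_le h1 (by fun_prop)
    · exact (h n c).trans (mul_le_mul_of_nonneg_left (weakLp_le_add hp _ _) hC)
  have h0 := lpSum_smul hp 0 (fun _ : Fin n => (0 : G))
  simp only [smul_zero, abs_zero, zero_mul] at h0
  simpa [h0] using key g

end PSumming

/-! ### Compositions are factorable strongly `p`-summing -/

section Comp

variable {X : Type u} [MetricSpace X] [Zero X]
  {E : Type v} [NormedAddCommGroup E] [NormedSpace ℝ E]
  {F : Type w} [NormedAddCommGroup F] [NormedSpace ℝ F]
  {G : Type t} [NormedAddCommGroup G] [NormedSpace ℝ G]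

/-- Every functional `f` in the dual ball yields the scalar Lip-linear map `f ∘ S`, of constant at
most `LipL(S)`. -/
theorem weakLp_diffSum_le {p : ℝ} (hp : 1 ≤ p) {ι κ : Type*} [Fintype ι] [Fintype κ]
    (x y : ι → κ → X) (e : ι → κ → E) (S : LipL0 X E G) :
    weakLp p (fun i => diffSum G (x i) (y i) (e i) S) ≤ lipLNorm S * weakDiff p x y e := by
  refine ciSup_le fun f => ?_
  simp only [← diffSum_postcomp]
  refine le_mul_weakDiff hp x y e ((lipLNorm_postcomp_le f.1 S).trans ?_)
  exact mul_le_of_le_one_left (lipLNorm_nonneg S) f.2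

theorem PSummingBound.factStrongBound {p : ℝ} (hp : 1 ≤ p) {a : G →L[ℝ] F} {C : ℝ} (hC : 0 ≤ C)
    (ha : PSummingBound p a C) {S : LipL0 X E G} {T : LipL0 X E F}
    (hT : ∀ x e, T.1 (x, e) = a (S.1 (x, e))) : FactStrongBound p T (C * lipLNorm S) := by
  obtain rfl : T = postcomp a S := by ext ⟨x, e⟩; exact hT x e
  refine factStrongBound_iff.2 fun n m x y e => ?_
  simp only [diffSum_postcomp]
  rw [mul_assoc]
  exact (ha n _).trans (mul_le_mul_of_nonneg_left (weakLp_diffSum_le hp x y e S) hC)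

end Comp

/-! ### The free space and linearization -/

section Free

variable (X : Type u) [MetricSpace X] [Zero X]
  (E : Type v) [NormedAddCommGroup E] [NormedSpace ℝ E]

open scoped ENNReal

/-- Bounded functions on the unit ball of `LipL₀(X × E; ℝ)`. -/
abbrev BallFunctions : Type (max u v t) := lp (fun _ : ULift.{t} (UnitBall X E) => ℝ) ∞

variable {X E}

theorem abs_unitBall_le (φ : UnitBall X E) (x : X) (e : E) :
    ‖φ.1.1 (x, e)‖ ≤ dist x 0 * ‖e‖ := by
  have h := norm_sub_le_lipLNorm φ.1 x 0 e
  rw [φ.1.2.2.2 e, sub_zero, mul_assoc] at h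
  exact h.trans (mul_le_of_le_one_left (by positivity) φ.2)

/-- Evaluation at a point, as a function on the unit ball. -/
def evalBall (q : X × E) : BallFunctions.{u, v, t} X E :=
  ⟨fun φ => φ.down.1.1 q, memℓp_infty ⟨dist q.1 0 * ‖q.2‖, by
    rintro _ ⟨φ, rfl⟩
    exact abs_unitBall_le φ.down q.1 q.2⟩⟩

variable (X E) in
/-- The linear combinations of evaluations. -/
def evalSpan : (X × E →₀ ℝ) →ₗ[ℝ] BallFunctions.{u, v, t} X E :=
  Finsupp.linearCombination ℝ evalBall

variable (X E) in
/-- The predual of `LipL₀(X × E; ℝ)`: the closed span of the evaluations. -/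
def FreeSpace : Type (max u v t) :=
  (LinearMap.range (evalSpan.{u, v, t} X E)).topologicalClosure

instance : NormedAddCommGroup (FreeSpace.{u, v, t} X E) :=
  inferInstanceAs
    (NormedAddCommGroup (LinearMap.range (evalSpan.{u, v, t} X E)).topologicalClosure)

instance : NormedSpace ℝ (FreeSpace.{u, v, t} X E) :=
  inferInstanceAs
    (NormedSpace ℝ (LinearMap.range (evalSpan.{u, v, t} X E)).topologicalClosure)

instance : CompleteSpace (FreeSpace.{u, v, t} X E) :=
  inferInstanceAs (CompleteSpace (LinearMap.range (evalSpan.{u, v, t} X E)).topologicalClosure)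

variable (X E) in
/-- The map onto the dense subspace of linear combinations of evaluations. -/
def toFree : (X × E →₀ ℝ) →ₗ[ℝ] FreeSpace.{u, v, t} X E :=
  (evalSpan X E).codRestrict _ fun c =>
    Submodule.le_topologicalClosure _ (LinearMap.mem_range_self _ c)

theorem denseRange_toFree : DenseRange (toFree.{u, v, t} X E) := by
  intro g
  refine closure_subtype.2 (closure_mono ?_ g.2)
  rintro _ ⟨c, rfl⟩
  exact ⟨_, ⟨c, rfl⟩, rfl⟩

theorem toFree_apply (c : X × E →₀ ℝ) (φ : ULift.{t} (UnitBall X E)) :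
    (toFree.{u, v, t} X E c).1 φ = c.sum fun q r => r * φ.down.1.1 q := by
  change (evalSpan X E c) φ = _
  rw [evalSpan, Finsupp.linearCombination_apply, Finsupp.sum, Finsupp.sum, lp.coeFn_sum,
    Finset.sum_apply]
  rfl

/-- The value at an element of the unit ball, as a functional on the free space. -/
def ballEval (φ : UnitBall X E) : StrongDual ℝ (FreeSpace.{u, v, t} X E) :=
  LinearMap.mkContinuous
    { toFun := fun g => g.1 ⟨φ⟩
      map_add' := fun _ _ => rfl
      map_smul' := fun _ _ => rfl } 1 fun g => by
    rw [one_mul]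
    exact lp.norm_apply_le_norm ENNReal.top_ne_zero g.1 ⟨φ⟩

/-- Places the test maps `φ` inside the dual ball of the free space, so the weak norm there
dominates the supremum over `φ`. -/
theorem norm_ballEval_le (φ : UnitBall X E) : ‖ballEval.{u, v, t} φ‖ ≤ 1 :=
  LinearMap.mkContinuous_norm_le _ zero_le_one _

/-- The canonical Lip-linear operator into the free space. -/
def toFreeLip : LipL0 X E (FreeSpace.{u, v, t} X E) :=
  ⟨fun q => toFree X E (Finsupp.single q 1), by
    refine ⟨fun x => ⟨fun a b => ?_, fun r a => ?_⟩, ⟨1, zero_le_one, fun x y e => ?_⟩, fun e => ?_⟩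
    -- Elements of the free space are determined by their coordinates `φ`, so each identity reduces
    -- to the same one for every `φ`.
    · refine Subtype.ext (lp.ext (funext fun φ => ?_))
      change (toFree X E _).1 φ = (toFree X E _).1 φ + (toFree X E _).1 φ
      simp only [toFree_apply, zero_mul, Finsupp.sum_single_index, one_mul]
      exact (φ.down.1.2.1 x).map_add a b
    · refine Subtype.ext (lp.ext (funext fun φ => ?_))
      change (toFree X E _).1 φ = r • (toFree X E _).1 φ
      simp only [toFree_apply, zero_mul, Finsupp.sum_single_index, one_mul]
      exact (φ.down.1.2.1 x).map_smul r a
    · refine lp.norm_le_of_forall_le (by positivity) fun φ => ?_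
      change ‖(toFree X E _).1 φ - (toFree X E _).1 φ‖ ≤ _
      simp only [toFree_apply, zero_mul, Finsupp.sum_single_index, one_mul]
      refine (norm_sub_le_lipLNorm φ.down.1 x y e).trans ?_
      rw [mul_assoc]
      exact mul_le_of_le_one_left (by positivity) φ.down.2
    · refine Subtype.ext (lp.ext (funext fun φ => ?_))
      change (toFree X E _).1 φ = 0
      simp only [toFree_apply, zero_mul, Finsupp.sum_single_index, one_mul]
      exact φ.down.1.2.2.2 e⟩

theorem toFreeLip_apply (q : X × E) :
    (toFreeLip.{u, v, t} (X := X) (E := E)).1 q = toFree X E (Finsupp.single q 1) :=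
  rfl

theorem lipLNorm_toFreeLip_le : lipLNorm (toFreeLip.{u, v, t} (X := X) (E := E)) ≤ 1 := by
  refine lipLNorm_le_of_forall zero_le_one fun x y e => ?_
  refine lp.norm_le_of_forall_le (by positivity) fun φ => ?_
  change ‖(toFree X E _).1 φ - (toFree X E _).1 φ‖ ≤ _
  simp only [toFree_apply, zero_mul, Finsupp.sum_single_index, one_mul]
  refine (norm_sub_le_lipLNorm φ.down.1 x y e).trans ?_
  rw [mul_assoc]
  exact mul_le_of_le_one_left (by positivity) φ.down.2

variable {F : Type w} [NormedAddCommGroup F] [NormedSpace ℝ F]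

/-! ### Factorization through the free space -/

/-- The coefficient is absorbed into `e` by linearity and the subtracted term vanishes at the base
point; this is how arbitrary linear combinations enter the defining inequality. -/
theorem diffSum_zero_smul (T : LipL0 X E F) (s : Finset (X × E)) (c : X × E → ℝ) :
    diffSum F (fun q : s => q.1.1) (fun _ => 0) (fun q => c q.1 • q.1.2) T
      = ∑ q ∈ s, c q • T.1 q := by
  change ∑ q : s, (T.1 (q.1.1, c q.1 • q.1.2) - T.1 (0, c q.1 • q.1.2)) = _
  rw [← Finset.sum_coe_sort s]
  refine Finset.sum_congr rfl fun q _ => ?_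
  rw [T.2.2.2, sub_zero]
  exact (T.2.1 q.1.1).map_smul (c q.1) q.1.2

theorem FactStrongBound.lpSum_linearCombination_le {p : ℝ} (hp : 1 ≤ p) {T : LipL0 X E F} {C : ℝ}
    (hC : 0 ≤ C) (hT : FactStrongBound p T C) {n : ℕ} (c : Fin n → X × E →₀ ℝ) :
    lpSum p (fun i => Finsupp.linearCombination ℝ T.1 (c i))
      ≤ C * weakLp p (toFree.{u, v, t} X E ∘ c) := by
  classical
  -- A common finite set containing all supports, since the inner index must be the same for every
  -- `i`.
  let s : Finset (X × E) := Finset.univ.biUnion fun i => (c i).support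
  have hs : ∀ i, (c i).support ⊆ s := fun i =>
    Finset.subset_biUnion_of_mem (fun i => (c i).support) (Finset.mem_univ i)
  have hsum : ∀ i, Finsupp.linearCombination ℝ T.1 (c i)
      = diffSum F (fun q : s => q.1.1) (fun _ => 0) (fun q => c i q.1 • q.1.2) T := fun i => by
    rw [diffSum_zero_smul, Finsupp.linearCombination_apply,
      Finsupp.sum_of_support_subset _ (hs i) _ (by simp)]
  simp only [hsum]
  refine (hT.le_weakDiff _ _ _).trans (mul_le_mul_of_nonneg_left (ciSup_le fun φ => ?_) hC)
  refine le_trans (le_of_eq ?_) (le_weakLp hp _ (norm_ballEval_le.{u, v, t} φ))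
  congr 1
  funext i
  rw [diffSum_zero_smul]
  change _ = (toFree X E (c i)).1 ⟨φ⟩
  rw [toFree_apply, Finsupp.sum_of_support_subset _ (hs i) _ (by simp)]
  rfl

/-- The case of one vector. It shows that the value depends only on the image of `c` in the free
space and that the induced map is bounded, hence extends by density. -/
theorem FactStrongBound.norm_linearCombination_le {p : ℝ} (hp : 1 ≤ p) {T : LipL0 X E F} {C : ℝ}
    (hC : 0 ≤ C) (hT : FactStrongBound p T C) (c : X × E →₀ ℝ) :
    ‖Finsupp.linearCombination ℝ T.1 c‖ ≤ C * ‖toFree.{u, v, t} X E c‖ := by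
  have h := hT.lpSum_linearCombination_le.{u, v, w, t} hp hC (fun _ : Fin 1 => c)
  rw [lpSum_unique hp] at h
  refine h.trans (mul_le_mul_of_nonneg_left (ciSup_le fun f => ?_) hC)
  refine (lpSum_dual_le hp _ f.2).trans ?_
  rw [lpSum_unique hp, Function.comp_apply]

/-- A factorable strongly `p`-summing operator factors through the free space by a `p`-summing
operator with the same constant. -/
theorem FactStrongBound.exists_factorization {p : ℝ} (hp : 1 ≤ p) [CompleteSpace F]
    {T : LipL0 X E F} {C : ℝ} (hC : 0 ≤ C) (hT : FactStrongBound p T C) :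
    ∃ a : FreeSpace.{u, v, t} X E →L[ℝ] F, PSummingBound p a C ∧
      ∀ x e, T.1 (x, e) = a (toFreeLip.1 (x, e)) := by
  obtain ⟨a, ha⟩ : ∃ a : FreeSpace.{u, v, t} X E →L[ℝ] F,
      ∀ c, a (toFree X E c) = Finsupp.linearCombination ℝ T.1 c :=
    ⟨_, LinearMap.extendOfNorm_eq denseRange_toFree.{u, v, t}
      ⟨C, hT.norm_linearCombination_le hp hC⟩⟩
  refine ⟨a, PSummingBound.of_denseRange hp denseRange_toFree hC fun n c => ?_, fun x e => ?_⟩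
  · simp only [ha]
    exact hT.lpSum_linearCombination_le hp hC c
  · rw [toFreeLip_apply, ha, Finsupp.linearCombination_single, one_smul]

theorem factStrong_eq_composition {p : ℝ} (hp : 1 ≤ p) [CompleteSpace F] :
    FactStrong p X E F = Composition.{u, v, w, max u v t} (fun G _ _ _ => PSumming p G F) X E := by
  ext T
  constructor
  · rintro ⟨C, hC, hT⟩
    obtain ⟨a, ha, hTa⟩ := hT.exists_factorization.{u, v, w, t} hp hC
    exact ⟨FreeSpace.{u, v, t} X E, inferInstance, inferInstance, inferInstance, toFreeLip, a,
      ⟨C, hC, ha⟩, hTa⟩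
  · rintro ⟨G, _, _, _, S, a, ⟨C, hC, ha⟩, hTa⟩
    exact ⟨C * lipLNorm S, mul_nonneg hC (lipLNorm_nonneg S), ha.factStrongBound hp hC hTa⟩

/-- The free-space factorization attains the infimum: its linear part has `π_p` at most the norm of
`T`, and `LipL` of the evaluation map is at most 1. -/
theorem factStrongNorm_eq_compositionNorm {p : ℝ} (hp : 1 ≤ p) [CompleteSpace F] {T : LipL0 X E F}
    (hT : T ∈ FactStrong p X E F) :
    factStrongNorm p T = compositionNorm.{u, v, w, max u v t} (fun G _ _ _ => PSumming p G F)
      (fun _ _ _ _ a => pSummingNorm p a) T := by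
  have hC := factStrongNorm_nonneg p T
  obtain ⟨a, ha, hTa⟩ :=
    (factStrongBound_factStrongNorm hT).exists_factorization.{u, v, w, t} hp hC
  apply le_antisymm
  · refine le_csInf ⟨_, FreeSpace.{u, v, t} X E, inferInstance, inferInstance, inferInstance,
      toFreeLip, a, ⟨_, hC, ha⟩, hTa, rfl⟩ ?_
    rintro r ⟨G, _, _, _, S, b, hb, hTb, rfl⟩
    exact factStrongNorm_le (mul_nonneg (pSummingNorm_nonneg p b) (lipLNorm_nonneg S))
      ((pSummingBound_pSummingNorm hb).factStrongBound hp (pSummingNorm_nonneg p b) hTb)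
  · have hle : pSummingNorm p a * lipLNorm (toFreeLip.{u, v, t} (X := X) (E := E))
        ≤ factStrongNorm p T :=
      (mul_le_of_le_one_right (pSummingNorm_nonneg p a) lipLNorm_toFreeLip_le).trans
        (csInf_le (bddBelow_nonneg _) ⟨hC, ha⟩)
    refine le_trans (csInf_le ⟨0, ?_⟩ ⟨FreeSpace.{u, v, t} X E, inferInstance, inferInstance,
      inferInstance, toFreeLip, a, ⟨_, hC, ha⟩, hTa, rfl⟩) hle
    rintro r ⟨G, _, _, _, S, b, hb, hTb, rfl⟩
    exact mul_nonneg (pSummingNorm_nonneg p b) (lipLNorm_nonneg S)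

end Free

theorem isBanachLipLinearIdeal_factStrong {p : ℝ} (hp : 1 ≤ p) :
    IsBanachLipLinearIdeal.{u, v, w} (fun X _ _ E _ _ _ F _ _ _ => FactStrong p X E F)
      (fun _ _ _ _ _ _ _ _ _ _ _ T => factStrongNorm p T) where
  subspace X _ _ E _ _ _ F _ _ _ := ⟨factStrongSubmodule X E F hp, rfl⟩
  elementary_mem _ _ _ _ _ _ _ _ _ _ _ f hf b z := elementary_mem_factStrong hp f hf b z
  sandwich_mem _ _ _ _ _ _ _ _ _ _ _ _ _ _ _ _ _ _ _ _ _ _ a T f hf c := by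
    rintro ⟨C, hC, hT⟩
    have := lipNorm_nonneg f
    exact ⟨_, by positivity, hT.sandwich hp hC a f hf c⟩
  norm_nonneg _ _ _ _ _ _ _ _ _ _ _ T _ := factStrongNorm_nonneg p T
  norm_eq_zero _ _ _ _ _ _ _ _ _ _ _ _ hT := factStrongNorm_eq_zero hp hT
  norm_smul _ _ _ _ _ _ _ _ _ _ _ r _ hT := factStrongNorm_smul hp r hT
  norm_add_le _ _ _ _ _ _ _ _ _ _ _ _ hS _ hT := factStrongNorm_add_le hp hS hT
  complete _ _ _ _ _ _ _ _ _ _ _ T hT hc := factStrong_complete hp T hT hc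
  lipLNorm_le _ _ _ _ _ _ _ _ _ _ _ _ hT := lipLNorm_le_factStrongNorm hp hT
  norm_mulReal := (factStrongNorm_mulReal hp).2
  norm_sandwich_le _ _ _ _ _ _ _ _ _ _ _ _ _ _ _ _ _ _ _ _ _ _ a T f hf c hT := by
    have h1 := lipNorm_nonneg f
    have h2 := factStrongNorm_nonneg p T
    exact factStrongNorm_le (by positivity)
      ((factStrongBound_factStrongNorm hT).sandwich hp h2 a f hf c)

end LipLinear

end

universe u v w t

/-- The universe of the auxiliary Banach spaces in the composition class may be any one that is at
least as large as those of `X` and `E`. -/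
theorem mainTheorem5 (p : ℝ) (hp : 1 ≤ p) :
    LipLinear.IsBanachLipLinearIdeal.{u, v, w}
      (fun X _ _ E _ _ _ F _ _ _ => LipLinear.FactStrong p X E F)
      (fun _ _ _ _ _ _ _ _ _ _ _ T => LipLinear.factStrongNorm p T) ∧
    ∀ (X : Type u) [MetricSpace X] [Zero X]
      (E : Type v) [NormedAddCommGroup E] [NormedSpace ℝ E] [CompleteSpace E]
      (F : Type w) [NormedAddCommGroup F] [NormedSpace ℝ F] [CompleteSpace F],
      LipLinear.FactStrong p X E F =
        LipLinear.Composition.{u, v, w, max u v t}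
          (fun G _ _ _ => LipLinear.PSumming p G F) X E ∧
      ∀ T ∈ LipLinear.FactStrong p X E F,
        LipLinear.factStrongNorm p T =
          LipLinear.compositionNorm.{u, v, w, max u v t}
            (fun G _ _ _ => LipLinear.PSumming p G F)
            (fun _ _ _ _ a => LipLinear.pSummingNorm p a) T := by
  refine ⟨LipLinear.isBanachLipLinearIdeal_factStrong hp, fun X _ _ E _ _ _ F _ _ _ => ⟨?_, ?_⟩⟩
  · exact LipLinear.factStrong_eq_composition.{u, v, w, t} hp
  · exact fun T hT => LipLinear.factStrongNorm_eq_compositionNorm.{u, v, w, t} hp hT
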